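/- Let $A$ be a unital $C^*$-algebra, $P \subset A$ a $C^*$-subalgebra containing the unit of $A$, and $E \colon A \to P$ a conditional expectation of finite index, i.e. a positive $P$-bimodule map with $E|_P = \mathrm{id}_P$ for which there are finitely many pairs $(u_i, v_i) \in A \times A$ (a quasi-basis) with $$a = \sum_i u_i E(v_i a) = \sum_i E(a u_i) v_i \qquad \text{for all } a \in A .$$ Let $A^\infty = \ell^\infty(\mathbb{N}, A)/c_0(A)$, where $c_0(A)$ is the ideal of sequences tending to $0$ in norm. Identify $A$ with the classes of constant sequences, let $P^\infty \subset A^\infty$ be the set of classes of bounded sequences in $P$, and put $P_\infty = P^\infty \cap P'$. Suppose that $E$ is approximately representable: there is a projection $e \in P_\infty$ such that $exe = E(x)e$ for all $x \in A$ and such that the map $P \ni x \mapsto xe$ is injective. Then $P' \cap A \subset P$. If moreover $P$ is simple (nonzero, with no closed two-sided ideals other than $0$ and $P$), then the inclusion $A \supset P$ is irreducible, i.e. $P' \cap A \cong \mathbb{C}$, and $A$ is simple. -/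

import Mathlib

open scoped BoundedContinuousFunction
open Filter Topology

namespace CStarInclusion

noncomputable section

universe u

variable (A : Type u) [CStarAlgebra A]

/-- The ideal `c₀(A)` of `ℓ^∞(ℕ, A)`: the bounded sequences that tend to `0` in norm.
The `C⋆`-algebra `ℓ^∞(ℕ, A)` of bounded sequences is `ℕ →ᵇ A`, with `ℕ` discrete. -/
def nullSequences : Ideal (ℕ →ᵇ A) where
  carrier := {f | Tendsto (fun n => ‖f n‖) atTop (𝓝 0)}
  zero_mem' := by simp
  add_mem' := by
    intro f g hf hg
    refine squeeze_zero (fun n => norm_nonneg _) (fun n => ?_) (by simpa using Tendsto.add hf hg)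
    exact norm_add_le (f n) (g n)
  smul_mem' := by
    intro c f hf
    refine squeeze_zero (g := fun n => ‖c‖ * ‖f n‖) (fun n => norm_nonneg _) (fun n => ?_)
      (by simpa using Tendsto.const_mul ‖c‖ hf)
    exact (norm_mul_le (c n) (f n)).trans
      (mul_le_mul_of_nonneg_right (c.norm_coe_le_norm n) (norm_nonneg _))

variable {A} in
theorem mem_nullSequences {f : ℕ →ᵇ A} :
    f ∈ nullSequences A ↔ Tendsto (fun n => ‖f n‖) atTop (𝓝 0) := Iff.rfl

instance : (nullSequences A).IsTwoSided where
  mul_mem_of_left := by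
    intro f c hf
    refine squeeze_zero (g := fun n => ‖f n‖ * ‖c‖) (fun n => norm_nonneg _) (fun n => ?_)
      (by simpa using Tendsto.mul_const ‖c‖ (mem_nullSequences.1 hf))
    exact (norm_mul_le (f n) (c n)).trans
      (mul_le_mul_of_nonneg_left (c.norm_coe_le_norm n) (norm_nonneg _))

theorem star_mem_nullSequences {f : ℕ →ᵇ A} (hf : f ∈ nullSequences A) :
    star f ∈ nullSequences A := by
  rw [mem_nullSequences] at hf ⊢
  simpa using hf

/-- The sequence algebra `A^∞ = ℓ^∞(ℕ, A) / c₀(A)`, as a quotient ring. -/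
abbrev SeqAlgebra : Type u := (ℕ →ᵇ A) ⧸ nullSequences A

/-- The involution of `A^∞`, induced by the pointwise involution of sequences. -/
instance : StarRing (SeqAlgebra A) where
  star := Quotient.map' star (by
    intro f g h
    rw [Submodule.quotientRel_def] at h ⊢
    simpa using star_mem_nullSequences A h)
  star_involutive := by
    rintro ⟨f⟩
    exact congrArg (Ideal.Quotient.mk (nullSequences A)) (star_star f)
  star_mul := by
    rintro ⟨f⟩ ⟨g⟩
    exact congrArg (Ideal.Quotient.mk (nullSequences A)) (star_mul f g)
  star_add := by
    rintro ⟨f⟩ ⟨g⟩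
    exact congrArg (Ideal.Quotient.mk (nullSequences A)) (star_add f g)

/-- The quotient map `ℓ^∞(ℕ, A) → A^∞`, as a unital `⋆`-homomorphism. -/
def SeqAlgebra.mk : (ℕ →ᵇ A) →⋆ₐ[ℂ] SeqAlgebra A where
  __ := Ideal.Quotient.mkₐ ℂ (nullSequences A)
  map_star' _ := rfl

variable {A}

/-- The map `A → A^∞` sending `a` to the class of the constant sequence `a`. -/
def SeqAlgebra.const (a : A) : SeqAlgebra A :=
  SeqAlgebra.mk A (BoundedContinuousFunction.const ℕ a)

/-- `P^∞` as a subset of `A^∞`: the classes of bounded sequences with all terms in `P`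
(the kernel of `ℓ^∞(ℕ, P) → A^∞` is `c₀(P)`, so this is a copy of `ℓ^∞(ℕ, P) / c₀(P)`). -/
def seqSubalgebra (P : StarSubalgebra ℂ A) : Set (SeqAlgebra A) :=
  SeqAlgebra.mk A '' {f | ∀ n, f n ∈ P}

/-- The central sequence algebra `P_∞ = P^∞ ∩ P'`, as a subset of `A^∞`. -/
def centralSeq (P : StarSubalgebra ℂ A) : Set (SeqAlgebra A) :=
  seqSubalgebra P ∩ Set.centralizer (SeqAlgebra.const '' (P : Set A))

/-- `E` is a conditional expectation from `A` onto `P`: a positive `P`-bimodule map `A → P`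
that restricts to the identity on `P`. -/
structure IsConditionalExpectation [PartialOrder A] [StarOrderedRing A]
    (P : StarSubalgebra ℂ A) (E : A →ₗ[ℂ] P) : Prop where
  apply_coe : ∀ p : P, E (p : A) = p
  map_mul_left : ∀ (p : P) (a : A), E ((p : A) * a) = p * E a
  map_mul_right : ∀ (a : A) (p : P), E (a * (p : A)) = E a * p
  map_nonneg : ∀ a : A, 0 ≤ a → 0 ≤ (E a : A)

/-- The finite family `(uᵢ, vᵢ)` is a quasi-basis for `E`. -/
def IsQuasiBasis (P : StarSubalgebra ℂ A) (E : A →ₗ[ℂ] P) {n : ℕ} (u v : Fin n → A) : Prop :=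
  ∀ a : A, a = ∑ i, u i * (E (v i * a) : A) ∧ a = ∑ i, (E (a * u i) : A) * v i

/-- `E` has finite (Watatani) index: it admits a quasi-basis. -/
def HasFiniteIndex (P : StarSubalgebra ℂ A) (E : A →ₗ[ℂ] P) : Prop :=
  ∃ (n : ℕ) (u v : Fin n → A), IsQuasiBasis P E u v

/-- `E` is approximately representable: some projection `e ∈ P_∞` satisfies `e x e = E(x) e`
in `A^∞` for all `x ∈ A`, and the map `P ∋ x ↦ x e` is injective. -/
def IsApproximatelyRepresentable (P : StarSubalgebra ℂ A) (E : A →ₗ[ℂ] P) : Prop :=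
  ∃ e ∈ centralSeq P, IsStarProjection e ∧
    (∀ x : A, e * SeqAlgebra.const x * e = SeqAlgebra.const (E x : A) * e) ∧
    Function.Injective (fun x : P => SeqAlgebra.const (x : A) * e)

/-- The inclusion `P ⊆ A` is irreducible: the relative commutant `P' ∩ A` is isomorphic to `ℂ`. -/
def IsIrreducibleInclusion (P : StarSubalgebra ℂ A) : Prop :=
  Nonempty (StarSubalgebra.centralizer ℂ (P : Set A) ≃⋆ₐ[ℂ] ℂ)

/-- A simple `C⋆`-algebra: it is nonzero and has no closed two-sided ideals other than `0` and
the whole algebra. -/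
def IsSimpleCStar (B : Type u) [Ring B] [TopologicalSpace B] : Prop :=
  Nontrivial B ∧ ∀ I : TwoSidedIdeal B, IsClosed (I : Set B) → I = ⊥ ∨ I = ⊤

end

end CStarInclusion

namespace CStarInclusion

/-! Right multiplication by `e` is injective on all of `A`: if `x e = 0`, then `E(v x) e = e v x e =
0`, so `E(v x) = 0` for every `v`, and the quasi-basis gives `x = 0`. An element `a` of `P'`
commutes with `e`, a class of a sequence in `P`; hence `a e = e a e = E(a) e` and `a = E(a) ∈ P`.
For simplicity of `A`, let `I` be a closed ideal with `I ∩ P = 0` and let `(fₙ)` in `P` represent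
`e`. For `x ∈ I`, `E(x) fₙ ∈ P` is asymptotically equal to `fₙ x fₙ ∈ I`. Since `P → A/I` is
isometric (`norm_le_norm_sub_of_disjoint`), `E(x) fₙ → 0`, so `E(x) = 0`; applied to all `v x`, this
gives `x = 0`. -/

section Ideals

variable {A : Type*} [CStarAlgebra A]

/-- If a selfadjoint `b` lies within distance less than `δ` of a closed ideal `I`, then the
cutoff `(b - δ)₊` lies in `I`. -/
theorem cfc_cutoff_mem (I : TwoSidedIdeal A) (hI : IsClosed (I : Set A)) {b y : A}
    (hb : IsSelfAdjoint b) (hy : y ∈ I) {δ : ℝ} (hδ : ‖b - y‖ < δ) :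
    cfc (fun t : ℝ => max (t - δ) 0) b ∈ I := by
  have hδ0 : 0 < δ := (norm_nonneg _).trans_lt hδ
  set z := b - y with hz
  -- Modulo `I`, `b` equals `z`, which has norm less than `δ`.
  have hpow : ∀ k : ℕ, b ^ k - z ^ k ∈ I := by
    intro k
    induction k with
    | zero => simp
    | succ k ih =>
      have : b ^ (k + 1) - z ^ (k + 1) = b ^ k * y + (b ^ k - z ^ k) * z := by
        rw [pow_succ, pow_succ, hz]; noncomm_ring
      rw [this]
      exact I.add_mem (I.mul_mem_left _ _ hy) (I.mul_mem_right _ _ ih)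
  -- The cutoff divided by `t ^ k`; `max t δ` only changes the denominator where the numerator
  -- vanishes. Then `‖g k (b)‖` is `O(δ⁻ᵏ)`, which `‖z‖ ^ k` beats.
  let g : ℕ → ℝ → ℝ := fun k t => max (t - δ) 0 / max t δ ^ k
  have hmax : ∀ t, 0 < max t δ := fun t => lt_max_of_lt_right hδ0
  have hg : ∀ k, Continuous (g k) := fun k =>
    Continuous.div (by fun_prop) (by fun_prop) fun t => (pow_pos (hmax t) k).ne'
  have hfac : ∀ k, cfc (fun t : ℝ => max (t - δ) 0) b = b ^ k * cfc (g k) b := by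
    intro k
    rw [← cfc_pow_id (R := ℝ) b k, ← cfc_mul (fun t : ℝ => t ^ k) (g k) b (by fun_prop)
      (hg k).continuousOn]
    refine cfc_congr fun t _ => ?_
    rcases le_total t δ with h | h
    · simp [g, h]
    · have : t ≠ 0 := (hδ0.trans_le h).ne'
      simp only [g, max_eq_left h]
      field_simp
  -- The factor `‖1‖` allows for the zero algebra.
  have hbound : ∀ k, ‖cfc (g k) b‖ ≤ ‖b‖ * ‖(1 : A)‖ / δ ^ k := by
    intro k
    refine norm_cfc_le (by positivity) fun t ht => ?_
    have ht' : |t| ≤ ‖b‖ * ‖(1 : A)‖ := spectrum.norm_le_norm_mul_of_mem ht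
    rw [Real.norm_of_nonneg (div_nonneg (le_max_right _ _) (pow_pos (hmax t) k).le)]
    have h1 : max (t - δ) 0 ≤ ‖b‖ * ‖(1 : A)‖ :=
      max_le (by linarith [le_abs_self t]) (by positivity)
    have h2 : δ ^ k ≤ max t δ ^ k := pow_le_pow_left₀ hδ0.le (le_max_right _ _) k
    gcongr
  have hlim : Tendsto (fun k => z ^ k * cfc (g k) b) atTop (𝓝 0) := by
    refine squeeze_zero_norm' (a := fun k => (‖z‖ / δ) ^ k * (‖b‖ * ‖(1 : A)‖)) ?_ ?_
    · filter_upwards [eventually_gt_atTop 0] with k hk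
      calc ‖z ^ k * cfc (g k) b‖ ≤ ‖z‖ ^ k * (‖b‖ * ‖(1 : A)‖ / δ ^ k) :=
            (norm_mul_le _ _).trans (mul_le_mul (norm_pow_le' z hk) (hbound k)
              (norm_nonneg _) (by positivity))
        _ = (‖z‖ / δ) ^ k * (‖b‖ * ‖(1 : A)‖) := by rw [div_pow]; ring
    · simpa using (tendsto_pow_atTop_nhds_zero_of_lt_one (by positivity)
        ((div_lt_one hδ0).2 hδ)).mul_const (‖b‖ * ‖(1 : A)‖)
  have hlim' : Tendsto (fun k => cfc (fun t : ℝ => max (t - δ) 0) b - z ^ k * cfc (g k) b) atTop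
      (𝓝 (cfc (fun t : ℝ => max (t - δ) 0) b)) := by
    simpa using hlim.const_sub (cfc (fun t : ℝ => max (t - δ) 0) b)
  refine hI.mem_of_tendsto hlim' (Eventually.of_forall fun k => ?_)
  rw [hfac k, ← sub_mul]
  exact I.mul_mem_right _ _ (hpow k)

/-- A closed ideal which meets a closed `⋆`-subalgebra `P` trivially does not come closer to
`p ∈ P` than `0` does. -/
theorem norm_le_norm_sub_of_disjoint (P : StarSubalgebra ℂ A) (hP : IsClosed (P : Set A))
    (I : TwoSidedIdeal A) (hI : IsClosed (I : Set A)) (hIP : ∀ p ∈ P, p ∈ I → p = 0)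
    {p y : A} (hp : p ∈ P) (hy : y ∈ I) : ‖p‖ ≤ ‖p - y‖ := by
  have hbP : star p * p ∈ P := mul_mem (star_mem hp) hp
  have hsq : ‖star p * p‖ ≤ ‖star p * p - star p * y‖ := by
    refine le_of_forall_gt_imp_ge_of_dense fun δ hδ => ?_
    have hδ0 : 0 < δ := (norm_nonneg _).trans_lt hδ
    -- The cutoff of `star p * p` lies in `I ∩ P`, so it vanishes and the spectrum is at most `δ`.
    have hc := cfc_cutoff_mem I hI (IsSelfAdjoint.star_mul_self p) (I.mul_mem_left (star p) y hy) hδ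
    have hc0 : cfc (fun t : ℝ => max (t - δ) 0) (star p * p) = 0 :=
      hIP _ (cfc_mem (𝕜' := ℂ) (hs := hP) _ hbP) hc
    have hspec : ∀ t ∈ spectrum ℝ (star p * p), ‖id t‖ ≤ δ := by
      intro t ht
      have h0 : 0 ≤ t := spectrum_star_mul_self_nonneg t ht
      have h1 := norm_apply_le_norm_cfc (fun t : ℝ => max (t - δ) 0) (star p * p) ht
      rw [hc0, norm_zero, Real.norm_of_nonneg (le_max_right _ _)] at h1
      rw [id, Real.norm_of_nonneg h0]
      linarith [le_max_left (t - δ) 0]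
    calc ‖star p * p‖ = ‖cfc (id : ℝ → ℝ) (star p * p)‖ := by rw [cfc_id ℝ (star p * p)]
      _ ≤ δ := norm_cfc_le hδ0.le hspec
  rw [← mul_sub, CStarRing.norm_star_mul_self] at hsq
  have h2 := hsq.trans (norm_mul_le _ _)
  rw [norm_star] at h2
  rcases (norm_nonneg p).eq_or_lt with h | h
  · rw [← h]; exact norm_nonneg _
  · exact le_of_mul_le_mul_left h2 h

/-- The centre of a simple unital `C⋆`-algebra consists of the scalars. -/
theorem IsSimpleCStar.exists_algebraMap_eq (hA : IsSimpleCStar A) {c : A}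
    (hc : ∀ a : A, c * a = a * c) : ∃ z : ℂ, algebraMap ℂ A z = c := by
  have := hA.1
  obtain ⟨z, hz⟩ := spectrum.nonempty c
  -- `z - c` is central and not invertible, so it generates a proper two-sided ideal, whose closure
  -- is still proper and hence zero.
  refine ⟨z, sub_eq_zero.1 ?_⟩
  set d := algebraMap ℂ A z - c with hd
  have hdc : ∀ a, d * a = a * d := fun a => by
    rw [hd, sub_mul, mul_sub, hc, Algebra.commutes]
  have hne : Ideal.span {d} ≠ ⊤ := by
    intro h
    obtain ⟨a, ha⟩ := Ideal.mem_span_singleton'.1 ((Ideal.eq_top_iff_one _).1 h)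
    exact hz ⟨⟨d, a, (hdc a).trans ha, ha⟩, rfl⟩
  have hspan : ∀ {x} (a : A), x ∈ Ideal.span {d} → x * a ∈ Ideal.span {d} := by
    intro x a hx
    obtain ⟨b, rfl⟩ := Ideal.mem_span_singleton'.1 hx
    rw [mul_assoc, hdc, ← mul_assoc]
    exact Ideal.mul_mem_left _ _ (Ideal.mem_span_singleton_self d)
  have : (Ideal.span {d}).closure.IsTwoSided :=
    ⟨fun a hx => map_mem_closure (f := fun x => x * a) (by fun_prop) hx fun _ h => hspan a h⟩
  have hmem : d ∈ (Ideal.span {d}).closure.toTwoSided :=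
    Ideal.mem_toTwoSided.2 (subset_closure (Ideal.mem_span_singleton_self d))
  rcases hA.2 (Ideal.span {d}).closure.toTwoSided
    (by rw [Ideal.coe_toTwoSided, Ideal.coe_closure]; exact isClosed_closure) with h | h
  · rw [h] at hmem
    exact hmem
  · refine absurd ?_ ((Ideal.span {d}).closure_ne_top hne)
    rw [← (Ideal.span {d}).closure.asIdeal_toTwoSided, h, TwoSidedIdeal.top_asIdeal]

end Ideals

section Inclusion

variable {A : Type*} [CStarAlgebra A] {P : StarSubalgebra ℂ A} {E : A →ₗ[ℂ] P}

theorem SeqAlgebra.const_mul (a b : A) :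
    SeqAlgebra.const (a * b) = SeqAlgebra.const a * SeqAlgebra.const b := by
  simp only [SeqAlgebra.const, ← map_mul]
  rfl

theorem SeqAlgebra.const_sub (a b : A) :
    SeqAlgebra.const (a - b) = SeqAlgebra.const a - SeqAlgebra.const b := by
  simp only [SeqAlgebra.const, ← map_sub]
  rfl

theorem SeqAlgebra.mk_eq_mk_iff {f g : ℕ →ᵇ A} :
    SeqAlgebra.mk A f = SeqAlgebra.mk A g ↔ Tendsto (fun n => ‖f n - g n‖) atTop (𝓝 0) :=
  Ideal.Quotient.eq.trans mem_nullSequences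

/-- An element which commutes with `P` commutes in `A^∞` with `P^∞`. -/
theorem commute_const_of_mem_seqSubalgebra {a : A} (ha : ∀ p ∈ P, p * a = a * p)
    {e : SeqAlgebra A} (he : e ∈ seqSubalgebra P) :
    e * SeqAlgebra.const a = SeqAlgebra.const a * e := by
  obtain ⟨f, hf, rfl⟩ := he
  simp only [SeqAlgebra.const, ← map_mul]
  congr 1
  ext n
  exact ha _ (hf n)

/-- A map with a quasi-basis is faithful in the strong sense that `E(va) = 0` for all `v`
forces `a = 0`. -/
theorem HasFiniteIndex.eq_zero (hfin : HasFiniteIndex P E) {a : A}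
    (h : ∀ v, E (v * a) = 0) : a = 0 := by
  obtain ⟨n, u, v, huv⟩ := hfin
  rw [(huv a).1]
  simp [h]

/-- The map `x ↦ x e` is injective on all of `A`. -/
theorem eq_zero_of_const_mul_eq_zero (hfin : HasFiniteIndex P E) {e : SeqAlgebra A}
    (hexe : ∀ x : A, e * SeqAlgebra.const x * e = SeqAlgebra.const (E x : A) * e)
    (hinj : Function.Injective (fun x : P => SeqAlgebra.const (x : A) * e)) {x : A}
    (hx : SeqAlgebra.const x * e = 0) : x = 0 := by
  refine hfin.eq_zero fun v => hinj ?_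
  have h0 : SeqAlgebra.const (0 : A) = 0 := map_zero (SeqAlgebra.mk A)
  simp only [← hexe, ZeroMemClass.coe_zero, h0, zero_mul]
  rw [SeqAlgebra.const_mul, mul_assoc, mul_assoc, hx, mul_zero, mul_zero]

/-- The relative commutant of an approximately representable inclusion lies in `P`. -/
theorem centralizer_le (hfin : HasFiniteIndex P E) (hrep : IsApproximatelyRepresentable P E) :
    StarSubalgebra.centralizer ℂ (P : Set A) ≤ P := by
  obtain ⟨e, ⟨heP, -⟩, he, hexe, hinj⟩ := hrep
  intro a ha
  have hcomm := commute_const_of_mem_seqSubalgebra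
    (fun p hp => ((StarSubalgebra.mem_centralizer_iff ℂ).1 ha p hp).1) heP
  have hz : SeqAlgebra.const (a - (E a : A)) * e = 0 := by
    rw [SeqAlgebra.const_sub, sub_mul, ← hexe, hcomm, mul_assoc, he.isIdempotentElem.eq, sub_self]
  rw [sub_eq_zero.1 (eq_zero_of_const_mul_eq_zero hfin hexe hinj hz)]
  exact (E a).2

/-- If `P` is simple and contains its relative commutant, the inclusion is irreducible. -/
theorem isIrreducibleInclusion_of_centralizer_le (hP : IsClosed (P : Set A))
    (hle : StarSubalgebra.centralizer ℂ (P : Set A) ≤ P) (hS : IsSimpleCStar P) :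
    IsIrreducibleInclusion P := by
  have : IsClosed (P : Set A) := hP
  have := hS.1
  have : Nontrivial A := Subtype.val_injective.nontrivial (α := P)
  refine ⟨(StarAlgEquiv.ofBijective
    (StarAlgHom.ofId ℂ (StarSubalgebra.centralizer ℂ (P : Set A))) ⟨?_, ?_⟩).symm⟩
  · exact FaithfulSMul.algebraMap_injective ℂ _
  · intro c
    obtain ⟨z, hz⟩ := hS.exists_algebraMap_eq (c := ⟨c, hle c.2⟩) fun p =>
      Subtype.ext ((StarSubalgebra.mem_centralizer_iff ℂ).1 c.2 p p.2).1.symm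
    exact ⟨z, Subtype.ext (congrArg (Subtype.val : P → A) hz)⟩

/-- A closed ideal of `A` which meets `P` trivially is zero. -/
theorem ideal_eq_bot_of_disjoint (hP : IsClosed (P : Set A)) (hfin : HasFiniteIndex P E)
    (hrep : IsApproximatelyRepresentable P E) (I : TwoSidedIdeal A) (hI : IsClosed (I : Set A))
    (hIP : ∀ p ∈ P, p ∈ I → p = 0) : I = ⊥ := by
  obtain ⟨e, ⟨⟨f, hf, rfl⟩, -⟩, -, hexe, hinj⟩ := hrep
  have hE : ∀ x ∈ I, E x = 0 := by
    intro x hx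
    have hx' := hexe x
    simp only [SeqAlgebra.const, ← map_mul] at hx'
    have hlim := SeqAlgebra.mk_eq_mk_iff.1 hx'.symm
    refine hinj ?_
    simp only [SeqAlgebra.const, ← map_mul]
    refine SeqAlgebra.mk_eq_mk_iff.2 (squeeze_zero (fun n => norm_nonneg _) (fun n => ?_) hlim)
    -- Compares `E(x) fₙ ∈ P` with `fₙ x fₙ ∈ I`.
    have h := norm_le_norm_sub_of_disjoint P hP I hI hIP (mul_mem (E x).2 (hf n))
      (I.mul_mem_right _ (f n) (I.mul_mem_left (f n) x hx))
    simpa using h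
  refine le_bot_iff.1 fun x hx => ?_
  rw [hfin.eq_zero fun v => hE _ (I.mul_mem_left v x hx)]
  exact TwoSidedIdeal.zero_mem _

/-- If `P` is simple, then so is `A`. -/
theorem isSimpleCStar_of_isApproximatelyRepresentable (hP : IsClosed (P : Set A))
    (hfin : HasFiniteIndex P E) (hrep : IsApproximatelyRepresentable P E)
    (hS : IsSimpleCStar P) : IsSimpleCStar A := by
  have := hS.1
  refine ⟨Subtype.val_injective.nontrivial (α := P), fun I hI => ?_⟩
  have hcl : IsClosed (I.comap P.subtype : Set P) := hI.preimage continuous_subtype_val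
  rcases hS.2 (I.comap P.subtype) hcl with h | h
  · refine Or.inl (ideal_eq_bot_of_disjoint hP hfin hrep I hI fun p hp hpI => ?_)
    have : (⟨p, hp⟩ : P) ∈ I.comap P.subtype := (TwoSidedIdeal.mem_comap P.subtype).2 hpI
    rw [h] at this
    exact congrArg Subtype.val (show (⟨p, hp⟩ : P) = 0 from this)
  · have h1 : (1 : P) ∈ I.comap P.subtype := by rw [h]; trivial
    have h1' : (1 : A) ∈ I := (TwoSidedIdeal.mem_comap P.subtype).1 h1
    exact Or.inr (I.one_mem_iff.1 h1')

end Inclusion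

end CStarInclusion

theorem mainTheorem9 {A : Type*} [CStarAlgebra A] [PartialOrder A] [StarOrderedRing A]
    (P : StarSubalgebra ℂ A) (hP : IsClosed (P : Set A))
    (E : A →ₗ[ℂ] P) (hE : CStarInclusion.IsConditionalExpectation P E)
    (hfin : CStarInclusion.HasFiniteIndex P E)
    (hrep : CStarInclusion.IsApproximatelyRepresentable P E) :
    StarSubalgebra.centralizer ℂ (P : Set A) ≤ P ∧
      (CStarInclusion.IsSimpleCStar P →
        CStarInclusion.IsIrreducibleInclusion P ∧ CStarInclusion.IsSimpleCStar A) := by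
  have hle := CStarInclusion.centralizer_le hfin hrep
  exact ⟨hle, fun hS => ⟨CStarInclusion.isIrreducibleInclusion_of_centralizer_le hP hle hS,
    CStarInclusion.isSimpleCStar_of_isApproximatelyRepresentable hP hfin hrep hS⟩⟩
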